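/- Let $\alpha\in(0,1]$ and let $\sigma_0,\sigma_1,\sigma_2,\dots$ be independent and identically distributed real random variables on a probability space with probability measure $\mathbf{P}$, such that \[\mathbf{P}(\sigma_0\ge u)=u^{-\alpha}\qquad\text{for all } u\ge 1.\] For $n\ge 1$ let \[M_n:=\max_{1\le i\le n}\sigma_i,\qquad S_n:=\sum_{1\le i\le n}\sigma_i .\] Then, $\mathbf{P}$-almost surely, \[\liminf_{n\to\infty}\frac{M_n}{S_n}=0,\qquad \limsup_{n\to\infty}\frac{M_n}{S_n}=1.\] -/

import Mathlib

open MeasureTheory ProbabilityTheory Filter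

noncomputable section

/-- `M_n = max_{1 ≤ i ≤ n} x_i`, the maximum of `x_1, …, x_n`. The index set is finite, and nonempty
for `n ≥ 1`, so the supremum is then a maximum; the value at `n = 0` is `0`. -/
def partialMax (x : ℕ → ℝ) (n : ℕ) : ℝ := ⨆ i : Finset.Icc 1 n, x i

/-- `S_n = ∑_{1 ≤ i ≤ n} x_i`, the sum of `x_1, …, x_n`. -/
def partialSum (x : ℕ → ℝ) (n : ℕ) : ℝ := ∑ i ∈ Finset.Icc 1 n, x i

end

/-! Put `τ = σ ^ α`, which has tail `1 / v`, so that `σ = τ ^ p` with `p = α⁻¹ ≥ 1`.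

Upper limit: `τ 1 + … + τ n` is at most `C n log n` with probability close to 1, while `τ (n + 1)`
exceeds a multiple of `n log n` infinitely often, since `∑ 1 / (n log n)` diverges.
`measure_compl_iUnion_inter_le` combines the two, so a term infinitely often exceeds `K` times the
preceding sum (`ae_frequently_mul_sum_le`). Superadditivity of `z ↦ z ^ p` carries this over to `σ`,
and the ratio is at least `K / (K + 1)`.

Lower limit: the maximum of `m` variables lies in `[m, 2m)` with probability bounded below. In
rapidly growing independent blocks of `k` groups, all `k` group maxima do so infinitely often, and
earlier terms eventually stay below `2m` (`ae_frequently_many_large`). The ratio is then at most `2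
^ p / k`. -/

/-- Independent random variables with values in `[1, ∞)` and tail `P(τ ≥ v) = 1 / v`. -/
structure IsParetoSeq {Ω : Type*} [MeasurableSpace Ω] (P : Measure Ω) (τ : ℕ → Ω → ℝ) : Prop where
  measurable : ∀ i, Measurable (τ i)
  indep : iIndepFun τ P
  one_le : ∀ i ω, 1 ≤ τ i ω
  tail : ∀ i v, 1 ≤ v → P.real {ω | v ≤ τ i ω} = v⁻¹

/-- The σ-algebra generated by the variables with index in `S`. -/
abbrev sigmaOn {Ω : Type*} (τ : ℕ → Ω → ℝ) (S : Set ℕ) : MeasurableSpace Ω :=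
  ⨆ i ∈ S, MeasurableSpace.comap (τ i) inferInstance

/-! ### Independence over disjoint index sets. -/

section SigmaOn

variable {Ω : Type*} {τ : ℕ → Ω → ℝ}

lemma sigmaOn_mono {S T : Set ℕ} (h : S ⊆ T) : sigmaOn τ S ≤ sigmaOn τ T :=
  biSup_mono h

lemma measurable_sigmaOn {S : Set ℕ} {i : ℕ} (hi : i ∈ S) : Measurable[sigmaOn τ S] (τ i) :=
  Measurable.mono (comap_measurable (τ i))
    (le_iSup₂_of_le (f := fun i (_ : i ∈ S) => MeasurableSpace.comap (τ i) inferInstance)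
      i hi le_rfl) le_rfl

variable [mΩ : MeasurableSpace Ω] {P : Measure Ω}

lemma sigmaOn_le (hτ : ∀ i, Measurable (τ i)) (S : Set ℕ) : sigmaOn τ S ≤ mΩ :=
  iSup₂_le fun i _ => (hτ i).comap_le

lemma measure_inter_of_sigmaOn (hτ : ∀ i, Measurable (τ i)) (hi : iIndepFun τ P)
    {S T : Set ℕ} (hST : Disjoint S T) {A B : Set Ω} (hA : MeasurableSet[sigmaOn τ S] A)
    (hB : MeasurableSet[sigmaOn τ T] B) : P (A ∩ B) = P A * P B :=
  (Indep_iff _ _ P).1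
    (indep_iSup_of_disjoint (fun i => (hτ i).comap_le) hi.iIndep hST) A B hA hB

/-- Events depending on disjoint groups of independent variables are independent. -/
lemma measure_biInter_of_sigmaOn {ι : Type*} [IsProbabilityMeasure P]
    (hτ : ∀ i, Measurable (τ i)) (hi : iIndepFun τ P) {S : ι → Set ℕ}
    (hS : Pairwise (Function.onFun Disjoint S)) {A : ι → Set Ω}
    (hA : ∀ j, MeasurableSet[sigmaOn τ (S j)] (A j)) (s : Finset ι) :
    P (⋂ j ∈ s, A j) = ∏ j ∈ s, P (A j) := by
  classical
  induction s using Finset.induction_on with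
  | empty => simp
  | insert a s ha ih =>
    rw [Finset.set_biInter_insert, Finset.prod_insert ha, ← ih]
    refine measure_inter_of_sigmaOn hτ hi (T := ⋃ j ∈ s, S j) ?_ (hA a) ?_
    · simp only [Set.disjoint_iUnion_right]
      exact fun j hj => hS (by rintro rfl; exact ha hj)
    · refine Finset.measurableSet_biInter s fun j hj => ?_
      exact sigmaOn_mono (Set.subset_biUnion_of_mem (u := S) hj) _ (hA j)

lemma iIndepSet_of_sigmaOn {ι : Type*} [IsProbabilityMeasure P]
    (hτ : ∀ i, Measurable (τ i)) (hi : iIndepFun τ P) {S : ι → Set ℕ}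
    (hS : Pairwise (Function.onFun Disjoint S)) {A : ι → Set Ω}
    (hA : ∀ j, MeasurableSet[sigmaOn τ (S j)] (A j)) : iIndepSet A P :=
  (iIndepSet_iff_meas_biInter fun j => sigmaOn_le hτ _ _ (hA j)).2
    (measure_biInter_of_sigmaOn hτ hi hS hA)

/-- If `A n` depends on `τ (n + 1)` only, `G n` on `τ 1, …, τ n`, the `A n` occur infinitely often
and each `G n` fails with probability at most `δ`, then `A n ∩ G n` fails for all large `n` with
probability at most `δ`. The proof decomposes along the last `n` at which `A n` occurs. -/
lemma measure_compl_iUnion_inter_le [IsProbabilityMeasure P]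
    (hτ : ∀ i, Measurable (τ i)) (hi : iIndepFun τ P) {A G : ℕ → Set Ω}
    (hA : ∀ n, MeasurableSet[sigmaOn τ {n + 1}] (A n))
    (hG : ∀ n, MeasurableSet[sigmaOn τ (Set.Iic n)] (G n))
    (hlim : P (limsup A atTop) = 1) {δ : ENNReal} {M : ℕ} (hδ : ∀ n, M ≤ n → P (G n)ᶜ ≤ δ) :
    P (⋃ n ≥ M, A n ∩ G n)ᶜ ≤ δ := by
  have hA' n : MeasurableSet (A n) := sigmaOn_le hτ _ _ (hA n)
  have hG' n : MeasurableSet (G n) := sigmaOn_le hτ _ _ (hG n)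
  have hV : MeasurableSet (⋃ n ≥ M, A n ∩ G n) :=
    .iUnion fun n => .iUnion fun _ => (hA' n).inter (hG' n)
  -- Cutting off at `N` ensures that a last occurrence exists; `N` is sent to infinity at the end.
  let U : ℕ → Set Ω := fun N => ⋃ n ∈ Finset.Ico M N, A n
  have hU : Monotone U := fun a b hab =>
    Set.biUnion_subset_biUnion_left fun n hn => by
      simp only [Finset.coe_Ico, Set.mem_Ico] at hn ⊢; omega
  have hfin N : P (U N \ ⋃ n ≥ M, A n ∩ G n) ≤ δ := by
    let D : ℕ → Set Ω := fun n => A n ∩ ⋂ l ∈ Finset.Ioo n N, (A l)ᶜ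
    have hD n : MeasurableSet[sigmaOn τ (Set.Ioi n)] (D n) := by
      refine MeasurableSet.inter (sigmaOn_mono (by simp) _ (hA n)) ?_
      refine Finset.measurableSet_biInter _ fun l hl => MeasurableSet.compl ?_
      refine sigmaOn_mono ?_ _ (hA l)
      simp only [Finset.mem_Ioo] at hl
      simp only [Set.singleton_subset_iff, Set.mem_Ioi]; omega
    have hsub : U N \ (⋃ n ≥ M, A n ∩ G n) ⊆ ⋃ n ∈ Finset.Ico M N, ((G n)ᶜ ∩ D n) := by
      rintro ω ⟨h1, h2⟩
      classical
      simp only [U, Set.mem_iUnion, exists_prop] at h1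
      let s := (Finset.Ico M N).filter (fun n => ω ∈ A n)
      have hs : s.Nonempty := by
        obtain ⟨n, hn, hn'⟩ := h1
        exact ⟨n, by simp [s, hn', Finset.mem_Ico.1 hn]⟩
      have hmem := s.max'_mem hs
      set n := s.max' hs
      simp only [s, Finset.mem_filter] at hmem
      simp only [Set.mem_iUnion, exists_prop]
      refine ⟨n, hmem.1, fun hg => h2 ?_, hmem.2, ?_⟩
      · simp only [Set.mem_iUnion]
        exact ⟨n, (Finset.mem_Ico.1 hmem.1).1, hmem.2, hg⟩
      · simp only [Set.mem_iInter]
        intro l hl hlA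
        rw [Finset.mem_Ioo] at hl
        have hh := Finset.mem_Ico.1 hmem.1
        have : l ≤ n := s.le_max' l (by simp [s, hlA]; omega)
        omega
    have hdisj : Set.PairwiseDisjoint (Finset.Ico M N : Set ℕ) D := by
      have key : ∀ a b, a < b → b < N → Disjoint (D a) (D b) := by
        intro a b hab hb
        refine Set.disjoint_left.2 fun ω h1 h2 => ?_
        have := h1.2
        simp only [Set.mem_iInter] at this
        exact this b (Finset.mem_Ioo.2 ⟨hab, hb⟩) h2.1
      intro a ha b hb hab
      simp only [Finset.coe_Ico, Set.mem_Ico] at ha hb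
      rcases lt_or_gt_of_ne hab with h | h
      · exact key a b h hb.2
      · exact (key b a h ha.2).symm
    calc P (U N \ ⋃ n ≥ M, A n ∩ G n)
        ≤ P (⋃ n ∈ Finset.Ico M N, ((G n)ᶜ ∩ D n)) := measure_mono hsub
      _ ≤ ∑ n ∈ Finset.Ico M N, P ((G n)ᶜ ∩ D n) := measure_biUnion_finset_le _ _
      _ = ∑ n ∈ Finset.Ico M N, P (G n)ᶜ * P (D n) := by
        refine Finset.sum_congr rfl fun n _ => ?_
        exact measure_inter_of_sigmaOn hτ hi (S := Set.Iic n) (T := Set.Ioi n)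
          (Set.disjoint_left.2 fun x hx hx' => by simp at hx hx'; omega) (hG n).compl (hD n)
      _ ≤ ∑ n ∈ Finset.Ico M N, δ * P (D n) := by
        refine Finset.sum_le_sum fun n hn => ?_
        gcongr
        exact hδ n (Finset.mem_Ico.1 hn).1
      _ = δ * P (⋃ n ∈ Finset.Ico M N, D n) := by
        rw [← Finset.mul_sum, measure_biUnion_finset hdisj fun n _ => sigmaOn_le hτ _ _ (hD n)]
      _ ≤ δ * 1 := by gcongr; exact prob_le_one
      _ = δ := mul_one δ
  have hcov : ∀ᵐ ω ∂P, ω ∈ ⋃ N, U N := by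
    have : ∀ᵐ ω ∂P, ω ∈ limsup A atTop :=
      (prob_compl_eq_zero_iff (MeasurableSet.measurableSet_limsup hA')).2 hlim
    filter_upwards [this] with ω hω
    rw [mem_limsup_iff_frequently_mem, frequently_atTop] at hω
    obtain ⟨n, hn, hnA⟩ := hω M
    simp only [U, Set.mem_iUnion, exists_prop]
    exact ⟨n + 1, n, by simp [hn], hnA⟩
  calc P (⋃ n ≥ M, A n ∩ G n)ᶜ
      ≤ P (⋃ N, (U N \ ⋃ n ≥ M, A n ∩ G n)) := by
        refine measure_mono_ae ?_
        filter_upwards [hcov] with ω hω h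
        obtain ⟨N, hN⟩ := Set.mem_iUnion.1 hω
        exact Set.mem_iUnion.2 ⟨N, hN, h⟩
    _ = ⨆ N, P (U N \ ⋃ n ≥ M, A n ∩ G n) :=
        Monotone.measure_iUnion fun a b hab => Set.sdiff_subset_sdiff_left (hU hab)
    _ ≤ δ := iSup_le hfin

end SigmaOn

/-! ### A single term dominating the preceding sum. -/

section Domination

variable {Ω : Type*} [MeasurableSpace Ω] {P : Measure Ω} {τ : ℕ → Ω → ℝ}

/-- For `2 ^ j ≤ t < 2 ^ (j + 1)` the right side is `2 ^ (j + 1)`. For a Pareto variable each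
summand has mean exactly 1, so the truncated mean is at most `1 + k`. -/
lemma le_one_add_sum_two_pow {t : ℝ} (ht : 1 ≤ t) (k : ℕ) (hk : t < 2 ^ k) :
    t ≤ 1 + ∑ j ∈ Finset.range k, if (2 : ℝ) ^ j ≤ t then (2 : ℝ) ^ j else 0 := by
  induction k with
  | zero => simp at hk; linarith
  | succ k ih =>
    by_cases h : t < 2 ^ k
    · rw [Finset.sum_range_succ, if_neg (not_le.2 h), add_zero]
      exact ih h
    · rw [not_lt] at h
      have : ∀ j ∈ Finset.range (k + 1), (if (2 : ℝ) ^ j ≤ t then (2 : ℝ) ^ j else 0) = 2 ^ j := by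
        intro j hj
        refine if_pos (le_trans ?_ h)
        exact pow_le_pow_right₀ (by norm_num) (by simpa [Nat.lt_succ_iff] using hj)
      rw [Finset.sum_congr rfl this, geom_sum_eq (by norm_num)]
      linarith

/-- Union bound above the level `2 ^ k`, Markov's inequality below it. -/
lemma IsParetoSeq.measureReal_lt_sum_le [IsProbabilityMeasure P] (h : IsParetoSeq P τ)
    (n k : ℕ) {x : ℝ} (hx : 0 < x) :
    P.real {ω | x < ∑ i ∈ Finset.Icc 1 n, τ i ω} ≤ n / 2 ^ k + n * (1 + k) / x := by
  let W : Ω → ℝ := fun ω => ∑ i ∈ Finset.Icc 1 n, (1 + ∑ j ∈ Finset.range k,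
    {ω | (2 : ℝ) ^ j ≤ τ i ω}.indicator (fun _ => (2 : ℝ) ^ j) ω)
  have hm i (c : ℝ) : MeasurableSet {ω | c ≤ τ i ω} := measurableSet_le measurable_const
    (h.measurable i)
  have hint i j : Integrable ({ω | (2 : ℝ) ^ j ≤ τ i ω}.indicator (fun _ => (2 : ℝ) ^ j)) P :=
    (integrable_const _).indicator (hm _ _)
  have hint' i : Integrable (fun ω => ∑ j ∈ Finset.range k,
      {ω | (2 : ℝ) ^ j ≤ τ i ω}.indicator (fun _ => (2 : ℝ) ^ j) ω) P :=
    integrable_finsetSum _ fun j _ => hint i j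
  have hint1 i : Integrable (fun ω => 1 + ∑ j ∈ Finset.range k,
      {ω | (2 : ℝ) ^ j ≤ τ i ω}.indicator (fun _ => (2 : ℝ) ^ j) ω) P :=
    (integrable_const _).add (hint' i)
  have hWint : Integrable W P := integrable_finsetSum _ fun i _ => hint1 i
  have hW : ∫ ω, W ω ∂P = n * (1 + k) := by
    have : ∀ i ∈ Finset.Icc 1 n, ∫ ω, (1 + ∑ j ∈ Finset.range k,
        {ω | (2 : ℝ) ^ j ≤ τ i ω}.indicator (fun _ => (2 : ℝ) ^ j) ω) ∂P = 1 + k := by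
      intro i _
      rw [integral_add (integrable_const _) (hint' i), integral_finsetSum _ fun j _ => hint i j]
      have : ∀ j ∈ Finset.range k, ∫ ω, {ω | (2 : ℝ) ^ j ≤ τ i ω}.indicator
          (fun _ => (2 : ℝ) ^ j) ω ∂P = 1 := by
        intro j _
        rw [integral_indicator_const _ (hm _ _), h.tail _ _ (one_le_pow₀ (by norm_num)),
          smul_eq_mul, inv_mul_cancel₀ (by positivity)]
      rw [Finset.sum_congr rfl this]
      simp
    rw [integral_finsetSum _ fun i _ => hint1 i,
      Finset.sum_congr rfl this, Finset.sum_const, Nat.card_Icc, nsmul_eq_mul, Nat.add_sub_cancel]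
  have hW0 : 0 ≤ W := fun ω => Finset.sum_nonneg fun i _ => add_nonneg zero_le_one <|
    Finset.sum_nonneg fun j _ => Set.indicator_nonneg (fun _ _ => by positivity) _
  have hsub : {ω | x < ∑ i ∈ Finset.Icc 1 n, τ i ω} ⊆
      (⋃ i ∈ Finset.Icc 1 n, {ω | (2 : ℝ) ^ k ≤ τ i ω}) ∪ {ω | x ≤ W ω} := by
    intro ω hω
    by_cases hb : ω ∈ ⋃ i ∈ Finset.Icc 1 n, {ω | (2 : ℝ) ^ k ≤ τ i ω}
    · exact Or.inl hb
    · refine Or.inr ((le_of_lt hω).trans (Finset.sum_le_sum fun i hi => ?_) : x ≤ W ω)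
      simp only [Set.mem_iUnion, exists_prop, not_exists, not_and, Set.mem_ofPred_eq, not_le] at hb
      have := le_one_add_sum_two_pow (h.one_le i ω) k (hb i hi)
      simpa only [Set.indicator_apply, Set.mem_ofPred_eq] using this
  have hU : P.real (⋃ i ∈ Finset.Icc 1 n, {ω | (2 : ℝ) ^ k ≤ τ i ω}) ≤ n / 2 ^ k := by
    refine (measureReal_biUnion_finset_le _ _).trans ?_
    rw [Finset.sum_congr rfl fun i _ => h.tail i _ (one_le_pow₀ (by norm_num))]
    simp [div_eq_mul_inv]
  have hM : P.real {ω | x ≤ W ω} ≤ n * (1 + k) / x := by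
    rw [le_div_iff₀ hx, mul_comm, ← hW]
    exact mul_meas_ge_le_integral_of_nonneg (Eventually.of_forall hW0) hWint x
  exact (measureReal_mono hsub).trans ((measureReal_union_le _ _).trans (add_le_add hU hM))

/-- `n log n`, up to constants. -/
def nlog (n : ℕ) : ℕ := n * (Nat.log 2 n + 1)

lemma nlog_mono : Monotone nlog := fun _ _ h =>
  Nat.mul_le_mul h (Nat.add_le_add_right (Nat.log_mono_right h) 1)

/-- Cauchy condensation turns the series into the harmonic series. -/
lemma not_summable_inv_nlog : ¬ Summable fun n : ℕ => ((nlog n : ℝ))⁻¹ := by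
  rw [← summable_condensed_iff_of_nonneg (fun n => by positivity)]
  · have : (fun k : ℕ => (2 : ℝ) ^ k * ((nlog (2 ^ k) : ℕ) : ℝ)⁻¹) =
        fun k : ℕ => ((k + 1 : ℕ) : ℝ)⁻¹ := by
      funext k
      simp [nlog, Nat.log_pow]
      field_simp
    rw [this, summable_nat_add_iff (f := fun k : ℕ => ((k : ℕ) : ℝ)⁻¹) 1]
    exact Real.not_summable_natCast_inv
  · intro m n hm hmn
    have : 0 < nlog m := Nat.mul_pos hm (Nat.succ_pos _)
    have h2 := nlog_mono hmn
    gcongr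

lemma IsParetoSeq.measureReal_mul_nlog_lt_sum_le [IsProbabilityMeasure P] (h : IsParetoSeq P τ)
    {n : ℕ} (hn : 0 < n) {C : ℝ} (hC : 0 < C) :
    P.real {ω | C * nlog n < ∑ i ∈ Finset.Icc 1 n, τ i ω} ≤ 1 / n + 3 / C := by
  have hn' : (0 : ℝ) < n := by exact_mod_cast hn
  set l := Nat.log 2 n with hl
  have hb : (nlog n : ℝ) = n * (l + 1) := by simp [nlog, hl]
  -- With `l = Nat.log 2 n`, truncation at `2 ^ (2 * (l + 1)) ≥ n ^ 2` makes the union bound at most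
  -- `1 / n`.
  refine (h.measureReal_lt_sum_le n (2 * (l + 1)) (by rw [hb]; positivity)).trans ?_
  have h1 : (n : ℝ) ≤ 2 ^ (l + 1) := by
    exact_mod_cast (Nat.lt_pow_succ_log_self (by norm_num : 1 < 2) n).le
  refine add_le_add ?_ ?_
  · rw [div_le_div_iff₀ (by positivity) hn', pow_mul', sq]
    nlinarith
  · rw [hb, div_le_div_iff₀ (by positivity) hC]
    push_cast
    have : (0 : ℝ) ≤ l := by positivity
    nlinarith [mul_pos hn' hC, mul_nonneg (mul_pos hn' hC).le this]

/-- Almost surely, infinitely many terms exceed any multiple of the sum of the previous ones. -/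
theorem IsParetoSeq.ae_frequently_mul_sum_le [IsProbabilityMeasure P] (h : IsParetoSeq P τ)
    (K : ℕ) :
    ∀ᵐ ω ∂P, ∃ᶠ n in atTop, K * ∑ i ∈ Finset.Icc 1 n, τ i ω ≤ τ (n + 1) ω := by
  refine le_antisymm (le_of_forall_pos_le_add fun δ hδ => ?_) zero_le
  rw [zero_add]
  obtain ⟨ε, hε, hεδ⟩ : ∃ ε : ℝ, 0 < ε ∧ ENNReal.ofReal ε ≤ δ := by
    rcases eq_or_ne δ ⊤ with rfl | hd
    · exact ⟨1, one_pos, le_top⟩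
    · exact ⟨δ.toReal, ENNReal.toReal_pos hδ.ne' hd, ENNReal.ofReal_toReal hd |>.le⟩
  -- `6 / ε` makes the Markov term `3 / C` at most `ε / 2`; `C ≥ 1` keeps thresholds in the range of
  -- the tail formula.
  let C : ℝ := max 1 (6 / ε)
  have hC1 : 1 ≤ C := le_max_left _ _
  have hC : 3 / C ≤ ε / 2 := by
    have : 6 / ε ≤ C := le_max_right _ _
    rw [div_le_iff₀ hε] at this
    rw [div_le_iff₀ (by positivity)]
    linarith
  let G : ℕ → Set Ω := fun n => {ω | ∑ i ∈ Finset.Icc 1 n, τ i ω ≤ C * nlog n}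
  -- The factor `K + 1` keeps the threshold at least 1 for `n ≥ 1` even when `K = 0`.
  let A : ℕ → Set Ω := fun n => {ω | (K + 1) * (C * nlog n) ≤ τ (n + 1) ω}
  have hA n : MeasurableSet[sigmaOn τ {n + 1}] (A n) :=
    measurableSet_le (@measurable_const _ _ _ (sigmaOn τ {n + 1}) _) (measurable_sigmaOn rfl)
  have hG n : MeasurableSet[sigmaOn τ (Set.Iic n)] (G n) := by
    refine measurableSet_le ?_ (@measurable_const _ _ _ (sigmaOn τ (Set.Iic n)) _)
    exact Finset.measurable_sum _ fun i hi => measurable_sigmaOn (Finset.mem_Icc.1 hi).2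
  have hlim : P (limsup A atTop) = 1 := by
    refine measure_limsup_eq_one (fun n => sigmaOn_le h.measurable _ _ (hA n))
      (iIndepSet_of_sigmaOn h.measurable h.indep (S := fun n => {n + 1}) ?_ hA) ?_
    · intro i j hij
      simpa [Function.onFun] using hij
    · by_contra htop
      have hs := ENNReal.summable_toReal htop
      refine not_summable_inv_nlog ?_
      refine (summable_mul_left_iff (a := ((K + 1) * C)⁻¹) (by positivity)).1 ?_
      refine hs.of_nonneg_of_le (fun n => by positivity) fun n => ?_
      change _ ≤ P.real (A n)
      rcases Nat.eq_zero_or_pos n with rfl | hn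
      · simp [nlog]
      · have : (1 : ℝ) ≤ nlog n := by
          exact_mod_cast Nat.mul_pos hn (Nat.succ_pos _)
        rw [h.tail]
        · rw [← mul_inv, mul_assoc]
        · have : 1 ≤ C * nlog n := one_le_mul_of_one_le_of_one_le hC1 this
          have hK : (0 : ℝ) ≤ K := by positivity
          nlinarith
  obtain ⟨M₀, hM₀⟩ := exists_nat_gt (2 / ε)
  have hGc n (hn : M₀ ≤ n) : P (G n)ᶜ ≤ δ := by
    refine le_trans ?_ hεδ
    have hn1 : 2 / ε < n := hM₀.trans_le (by exact_mod_cast hn)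
    have hn0 : (0 : ℝ) < n := lt_trans (by positivity) hn1
    rw [← ofReal_measureReal]
    refine ENNReal.ofReal_le_ofReal ?_
    have : (G n)ᶜ = {ω | C * nlog n < ∑ i ∈ Finset.Icc 1 n, τ i ω} := by
      ext ω; simp [G]
    rw [this]
    refine (h.measureReal_mul_nlog_lt_sum_le (by exact_mod_cast hn0) (by positivity)).trans ?_
    have : 1 / (n : ℝ) ≤ ε / 2 := by
      rw [div_lt_iff₀ hε] at hn1
      rw [div_le_iff₀ hn0]
      linarith
    linarith
  have hV M : P (⋃ n ≥ M, A n ∩ G n)ᶜ ≤ δ := by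
    refine le_trans (measure_mono (Set.compl_subset_compl.2 ?_))
      (measure_compl_iUnion_inter_le h.measurable h.indep hA hG hlim
        (M := max M M₀) fun n hn => hGc n ((le_max_right _ _).trans hn))
    exact Set.biUnion_subset_biUnion_left fun n (hn : max M M₀ ≤ n) => (le_max_left _ _).trans hn
  calc P {ω | ∃ᶠ n in atTop, K * ∑ i ∈ Finset.Icc 1 n, τ i ω ≤ τ (n + 1) ω}ᶜ
      -- The events of no success from `M` on increase with `M`, so their union obeys the same bound
      -- `δ`.
      ≤ P (⋃ M, (⋃ n ≥ M, A n ∩ G n)ᶜ) := by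
        refine measure_mono fun ω hω => ?_
        by_contra hcon
        refine hω (frequently_atTop.2 fun M => ?_)
        simp only [Set.mem_iUnion, not_exists, Set.mem_compl_iff] at hcon
        obtain ⟨n, hn, hnA, hnG⟩ : ∃ n ≥ M, ω ∈ A n ∩ G n := by
          simpa using hcon M
        refine ⟨n, hn, le_trans ?_ hnA⟩
        have h0 : 0 ≤ ∑ i ∈ Finset.Icc 1 n, τ i ω :=
          Finset.sum_nonneg fun i _ => zero_le_one.trans (h.one_le i ω)
        have hK : (0 : ℝ) ≤ K := by positivity
        have : ∑ i ∈ Finset.Icc 1 n, τ i ω ≤ C * nlog n := hnG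
        nlinarith
    _ = ⨆ M, P (⋃ n ≥ M, A n ∩ G n)ᶜ := by
        refine Monotone.measure_iUnion fun a b hab => Set.compl_subset_compl.2 ?_
        exact Set.biUnion_subset_biUnion_left fun n (hn : b ≤ n) => hab.trans hn
    _ ≤ δ := iSup_le hV

end Domination

/-! ### Many terms comparable to the maximum. -/

section ManyLarge

variable {Ω : Type*} {τ : ℕ → Ω → ℝ}

/-- The maximum of `τ` over `I` lies in `[y, 2 y)`. -/
def maxInDyadic (τ : ℕ → Ω → ℝ) (I : Finset ℕ) (y : ℝ) : Set Ω :=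
  {ω | (∀ i ∈ I, τ i ω < 2 * y) ∧ ∃ i ∈ I, y ≤ τ i ω}

lemma measurableSet_maxInDyadic (I : Finset ℕ) (y : ℝ) :
    MeasurableSet[sigmaOn τ I] (maxInDyadic τ I y) := by
  have heq : maxInDyadic τ I y =
      (⋂ i ∈ I, τ i ⁻¹' Set.Iio (2 * y)) ∩ ⋃ i ∈ I, τ i ⁻¹' Set.Ici y := by
    ext; simp [maxInDyadic]
  rw [heq]
  exact (Finset.measurableSet_biInter I fun i hi => measurable_sigmaOn hi measurableSet_Iio).inter
    (Finset.measurableSet_biUnion I fun i hi => measurable_sigmaOn hi measurableSet_Ici)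

variable [MeasurableSpace Ω] {P : Measure Ω}

lemma IsParetoSeq.measureReal_forall_lt [IsProbabilityMeasure P] (h : IsParetoSeq P τ)
    (I : Finset ℕ) {v : ℝ} (hv : 1 ≤ v) :
    P.real {ω | ∀ i ∈ I, τ i ω < v} = (1 - v⁻¹) ^ I.card := by
  have heq : {ω | ∀ i ∈ I, τ i ω < v} = ⋂ i ∈ I, τ i ⁻¹' Set.Iio v := by ext; simp
  have h1 i : P.real (τ i ⁻¹' Set.Iio v) = 1 - v⁻¹ := by
    have hc : τ i ⁻¹' Set.Iio v = {ω | v ≤ τ i ω}ᶜ := by ext; simp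
    rw [hc, probReal_compl_eq_one_sub (measurableSet_le measurable_const (h.measurable i)),
      h.tail i v hv]
  rw [heq, measureReal_def, h.indep.measure_inter_preimage_eq_mul I fun i _ => measurableSet_Iio,
    ENNReal.toReal_prod, ← Finset.prod_const]
  exact Finset.prod_congr rfl fun i _ => h1 i

lemma IsParetoSeq.measureReal_maxInDyadic [IsProbabilityMeasure P] (h : IsParetoSeq P τ)
    (I : Finset ℕ) {y : ℝ} (hy : 1 ≤ y) :
    P.real (maxInDyadic τ I y) = (1 - (2 * y)⁻¹) ^ I.card - (1 - y⁻¹) ^ I.card := by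
  have heq : maxInDyadic τ I y = {ω | ∀ i ∈ I, τ i ω < 2 * y} \ {ω | ∀ i ∈ I, τ i ω < y} := by
    ext; simp [maxInDyadic]
  have hm : MeasurableSet {ω | ∀ i ∈ I, τ i ω < y} := by
    have : {ω | ∀ i ∈ I, τ i ω < y} = ⋂ i ∈ I, τ i ⁻¹' Set.Iio y := by ext; simp
    rw [this]
    exact Finset.measurableSet_biInter I fun i _ => h.measurable i measurableSet_Iio
  rw [heq, measureReal_sdiff (fun ω hω i hi => (hω i hi).trans (by linarith)) hm,
    h.measureReal_forall_lt I (by linarith), h.measureReal_forall_lt I hy]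

/-- The difference tends to `exp (-1/2) - exp (-1) > 0`. It is the probability that the maximum of
`m` variables lies in `[m, 2m)`. -/
lemma exists_pos_eventually_le_pow_sub_pow :
    ∃ c : ℝ, 0 < c ∧ ∀ᶠ m : ℕ in atTop, c ≤ (1 - (2 * (m : ℝ))⁻¹) ^ m - (1 - (m : ℝ)⁻¹) ^ m := by
  have h1 := (Real.tendsto_one_add_div_pow_exp (-(1 / 2))).sub
    (Real.tendsto_one_add_div_pow_exp (-1))
  have hpos : 0 < Real.exp (-(1 / 2)) - Real.exp (-1) :=
    sub_pos.2 (Real.exp_lt_exp.2 (by norm_num))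
  refine ⟨(Real.exp (-(1 / 2)) - Real.exp (-1)) / 2, by linarith, ?_⟩
  filter_upwards [h1.eventually_const_le (half_lt_self hpos)] with m hm
  have e1 : 1 - (2 * (m : ℝ))⁻¹ = 1 + -(1 / 2) / m := by rw [mul_inv]; ring
  have e2 : 1 - (m : ℝ)⁻¹ = 1 + -1 / m := by ring
  rwa [e1, e2]

/-- End points of blocks growing so fast that each block is much longer than its predecessors
together. -/
def blockEnd (k : ℕ) : ℕ → ℕ
  | 0 => 0
  | j + 1 => blockEnd k j + k * (2 ^ j * (blockEnd k j + 1))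

/-- The length of each of the `k` groups in the `j`-th block. -/
def groupLen (k j : ℕ) : ℕ := 2 ^ j * (blockEnd k j + 1)

lemma blockEnd_succ (k j : ℕ) : blockEnd k (j + 1) = blockEnd k j + k * groupLen k j := rfl

lemma blockEnd_mono (k : ℕ) : Monotone (blockEnd k) :=
  monotone_nat_of_le_succ fun _ => Nat.le_add_right _ _

lemma two_pow_le_groupLen (k j : ℕ) : 2 ^ j ≤ groupLen k j :=
  Nat.le_mul_of_pos_right _ (Nat.succ_pos _)

lemma le_blockEnd {k : ℕ} (hk : 0 < k) (j : ℕ) : j ≤ blockEnd k j := by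
  induction j with
  | zero => exact Nat.zero_le _
  | succ j ih =>
    rw [blockEnd_succ]
    have h1 : 0 < groupLen k j := (pow_pos two_pos j).trans_le (two_pow_le_groupLen k j)
    have := Nat.mul_pos hk h1
    omega

/-- The `i`-th group of indices in the `j`-th block. -/
def group (k j i : ℕ) : Finset ℕ :=
  Finset.Ioc (blockEnd k j + i * groupLen k j) (blockEnd k j + (i + 1) * groupLen k j)

lemma card_group (k j i : ℕ) : (group k j i).card = groupLen k j := by
  rw [group, Nat.card_Ioc, Nat.add_mul]; omega

lemma disjoint_group {k j i i' : ℕ} (h : i ≠ i') : Disjoint (group k j i) (group k j i') := by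
  wlog hlt : i < i' generalizing i i'
  · exact (this h.symm (by omega)).symm
  have : (i + 1) * groupLen k j ≤ i' * groupLen k j := Nat.mul_le_mul_right _ hlt
  refine Finset.disjoint_left.2 fun x hx hx' => ?_
  rw [group, Finset.mem_Ioc] at hx hx'
  omega

lemma group_subset {k j i : ℕ} (hi : i < k) :
    group k j i ⊆ Finset.Ioc (blockEnd k j) (blockEnd k (j + 1)) := by
  have : (i + 1) * groupLen k j ≤ k * groupLen k j := Nat.mul_le_mul_right _ hi
  refine Finset.Ioc_subset_Ioc (Nat.le_add_right _ _) ?_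
  rw [blockEnd_succ]; omega

lemma exists_mem_group {k j x : ℕ} (hx : x ∈ Finset.Ioc (blockEnd k j) (blockEnd k (j + 1))) :
    ∃ i < k, x ∈ group k j i := by
  rw [Finset.mem_Ioc, blockEnd_succ] at hx
  have hm : 0 < groupLen k j := (pow_pos two_pos j).trans_le (two_pow_le_groupLen k j)
  set m := groupLen k j with hmdef
  -- The `- 1` is there because groups are open on the left and closed on the right.
  refine ⟨(x - blockEnd k j - 1) / m, ?_, ?_⟩
  · rw [Nat.div_lt_iff_lt_mul hm]; omega
  · rw [group, Finset.mem_Ioc, ← hmdef]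
    have h1 := Nat.div_mul_le_self (x - blockEnd k j - 1) m
    have h2 := Nat.lt_div_mul_add (a := x - blockEnd k j - 1) hm
    rw [Nat.add_mul]
    omega

lemma pairwise_disjoint_block (k : ℕ) : Pairwise (Function.onFun Disjoint
    fun j => (Finset.Ioc (blockEnd k j) (blockEnd k (j + 1)) : Set ℕ)) := by
  intro j j' h
  wlog hlt : j < j' generalizing j j'
  · exact (this h.symm (by omega)).symm
  have := blockEnd_mono k (Nat.succ_le_of_lt hlt)
  refine Set.disjoint_left.2 fun x hx hx' => ?_
  simp only [Finset.coe_Ioc, Set.mem_Ioc, Nat.succ_eq_add_one] at hx hx' this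
  omega

/-- Groups within a block are independent, so the probabilities are eventually at least `c ^ k`;
blocks are independent too, and the second Borel–Cantelli lemma applies. -/
lemma IsParetoSeq.ae_frequently_blocks [IsProbabilityMeasure P] (h : IsParetoSeq P τ) (k : ℕ) :
    ∀ᵐ ω ∂P, ∃ᶠ j in atTop, ∀ i < k, ω ∈ maxInDyadic τ (group k j i) (groupLen k j) := by
  let A : ℕ → Set Ω := fun j =>
    ⋂ i ∈ Finset.range k, maxInDyadic τ (group k j i) (groupLen k j)
  have hA j : MeasurableSet[sigmaOn τ (Finset.Ioc (blockEnd k j) (blockEnd k (j + 1)))] (A j) :=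
    Finset.measurableSet_biInter _ fun i hi => sigmaOn_mono
      (Finset.coe_subset.2 (group_subset (Finset.mem_range.1 hi))) _ (measurableSet_maxInDyadic _ _)
  have hA' j : MeasurableSet (A j) := sigmaOn_le h.measurable _ _ (hA j)
  have hPA j : P.real (A j) = ((1 - (2 * (groupLen k j : ℝ))⁻¹) ^ groupLen k j -
      (1 - (groupLen k j : ℝ)⁻¹) ^ groupLen k j) ^ k := by
    have hm : (1 : ℝ) ≤ groupLen k j := by
      exact_mod_cast (Nat.one_le_two_pow (n := j)).trans (two_pow_le_groupLen k j)
    rw [measureReal_def, measure_biInter_of_sigmaOn h.measurable h.indep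
      (S := fun i => (group k j i : Set ℕ))
      (fun i i' hi => Finset.disjoint_coe.2 (disjoint_group hi))
      (fun i => measurableSet_maxInDyadic _ _), ENNReal.toReal_prod]
    have : ∀ i ∈ Finset.range k, (P (maxInDyadic τ (group k j i) (groupLen k j))).toReal = _ :=
      fun i _ => h.measureReal_maxInDyadic (group k j i) hm
    rw [Finset.prod_congr rfl this]
    simp [card_group]
  have hlim : P (limsup A atTop) = 1 := by
    refine measure_limsup_eq_one hA'
      (iIndepSet_of_sigmaOn h.measurable h.indep (pairwise_disjoint_block k) hA) ?_
    by_contra htop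
    have hs : Tendsto (fun j => P.real (A j)) atTop (nhds 0) :=
      (ENNReal.summable_toReal htop).tendsto_atTop_zero
    obtain ⟨c, hc, hev⟩ := exists_pos_eventually_le_pow_sub_pow
    have hg : Tendsto (groupLen k) atTop atTop :=
      tendsto_atTop_mono (two_pow_le_groupLen k) (tendsto_pow_atTop_atTop_of_one_lt one_lt_two)
    have hge : ∀ᶠ j in atTop, c ^ k ≤ P.real (A j) := by
      filter_upwards [hg.eventually hev] with j hj
      rw [hPA]
      gcongr
    have := ge_of_tendsto hs hge
    have := pow_pos hc k
    linarith
  have : ∀ᵐ ω ∂P, ω ∈ limsup A atTop :=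
    (prob_compl_eq_zero_iff (MeasurableSet.measurableSet_limsup hA')).2 hlim
  filter_upwards [this] with ω hω
  rw [mem_limsup_iff_frequently_mem] at hω
  simpa [A] using hω

/-- The factor `2 ^ j` in `groupLen` makes the union bound at most `2 ^ (-j)`, which is summable,
and the first Borel–Cantelli lemma applies. -/
lemma IsParetoSeq.ae_eventually_initial [IsProbabilityMeasure P] (h : IsParetoSeq P τ) (k : ℕ) :
    ∀ᵐ ω ∂P, ∀ᶠ j in atTop, ∀ i ∈ Finset.Icc 1 (blockEnd k j), τ i ω < 2 * groupLen k j := by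
  let F : ℕ → Set Ω := fun j => ⋃ i ∈ Finset.Icc 1 (blockEnd k j), {ω | 2 * groupLen k j ≤ τ i ω}
  have hF j : P.real (F j) ≤ (1 / 2) ^ j := by
    have hp : (2 : ℝ) ^ j * (blockEnd k j + 1) = groupLen k j := by simp [groupLen]
    have h2 : (1 : ℝ) ≤ 2 ^ j := one_le_pow₀ (by norm_num)
    have hb : (0 : ℝ) ≤ blockEnd k j := by positivity
    have hm : (1 : ℝ) ≤ 2 * groupLen k j := by rw [← hp]; nlinarith
    refine (measureReal_biUnion_finset_le _ _).trans ?_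
    rw [Finset.sum_congr rfl fun i _ => h.tail i _ hm, Finset.sum_const, Nat.card_Icc,
      nsmul_eq_mul, Nat.add_sub_cancel, ← hp, ← div_eq_mul_inv, one_div, inv_pow, ← one_div,
      div_le_div_iff₀ (by positivity) (by positivity)]
    nlinarith
  have hsum : ∑' j, P (F j) ≠ ⊤ := by
    have : ∀ j, P (F j) ≤ ENNReal.ofReal ((1 / 2) ^ j) := fun j => by
      rw [← ofReal_measureReal (measure_ne_top P _)]; exact ENNReal.ofReal_le_ofReal (hF j)
    refine ne_top_of_le_ne_top ?_ (ENNReal.tsum_le_tsum this)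
    exact (summable_geometric_of_lt_one (by norm_num) (by norm_num)).tsum_ofReal_ne_top
  filter_upwards [ae_eventually_notMem hsum] with ω hω
  filter_upwards [hω] with j hj
  simpa [F] using hj

/-- Almost surely, for infinitely many `n`, at least `k` of the first `n` terms are within a factor
`2` of their maximum. -/
theorem IsParetoSeq.ae_frequently_many_large [IsProbabilityMeasure P] (h : IsParetoSeq P τ)
    {k : ℕ} (hk : 0 < k) :
    ∀ᵐ ω ∂P, ∃ᶠ n in atTop, ∃ y : ℝ, 0 < y ∧ (∀ i ∈ Finset.Icc 1 n, τ i ω < 2 * y) ∧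
      ∃ s ⊆ Finset.Icc 1 n, k ≤ s.card ∧ ∀ i ∈ s, y ≤ τ i ω := by
  filter_upwards [h.ae_frequently_blocks k, h.ae_eventually_initial k] with ω h1 h2
  refine frequently_atTop.2 fun M => ?_
  obtain ⟨j, hj, hA, hI⟩ := frequently_atTop.1 (h1.and_eventually h2) M
  refine ⟨blockEnd k (j + 1), ?_, groupLen k j, ?_, ?_, ?_⟩
  · have := le_blockEnd hk (j + 1)
    omega
  · exact_mod_cast (pow_pos two_pos j).trans_le (two_pow_le_groupLen k j)
  · intro i hi
    by_cases hij : i ≤ blockEnd k j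
    · exact hI i (Finset.mem_Icc.2 ⟨(Finset.mem_Icc.1 hi).1, hij⟩)
    · obtain ⟨l, hl, hil⟩ := exists_mem_group
        (Finset.mem_Ioc.2 ⟨not_le.1 hij, (Finset.mem_Icc.1 hi).2⟩)
      exact (hA l hl).1 i hil
  -- One large term per group; disjointness of the groups makes the `k` indices distinct.
  · choose! x hx hxy using fun i (hi : i < k) => (hA i hi).2
    refine ⟨(Finset.range k).image x, ?_, ?_, ?_⟩
    · intro z hz
      obtain ⟨i, hi, rfl⟩ := Finset.mem_image.1 hz
      have hi := Finset.mem_range.1 hi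
      have := Finset.mem_Ioc.1 (group_subset hi (hx i hi))
      exact Finset.mem_Icc.2 ⟨by omega, this.2⟩
    · rw [Finset.card_image_of_injOn, Finset.card_range]
      intro i hi i' hi' heq
      simp only [Finset.coe_range, Set.mem_Iio] at hi hi'
      by_contra hne
      exact Finset.disjoint_left.1 (disjoint_group hne) (hx i hi) (heq ▸ hx i' hi')
    · intro z hz
      obtain ⟨i, hi, rfl⟩ := Finset.mem_image.1 hz
      exact hxy i (Finset.mem_range.1 hi)

end ManyLarge

/-! ### From the Pareto sequence to the ratio, pathwise. -/

section Ratio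

variable {x : ℕ → ℝ}

lemma le_partialMax {n i : ℕ} (hi : i ∈ Finset.Icc 1 n) : x i ≤ partialMax x n :=
  le_ciSup (f := fun i : Finset.Icc 1 n => x i) (Set.finite_range _).bddAbove ⟨i, hi⟩

/-- The sign condition covers `n = 0`, where the empty supremum is 0. -/
lemma partialMax_le {n : ℕ} {c : ℝ} (hc : 0 ≤ c) (h : ∀ i ∈ Finset.Icc 1 n, x i ≤ c) :
    partialMax x n ≤ c :=
  Real.iSup_le (fun i => h i i.2) hc

lemma ratio_nonneg (hx : ∀ i, 0 ≤ x i) (n : ℕ) : 0 ≤ partialMax x n / partialSum x n :=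
  div_nonneg (Real.iSup_nonneg fun _ => hx _) (Finset.sum_nonneg fun _ _ => hx _)

lemma ratio_le_one (hx : ∀ i, 0 ≤ x i) (n : ℕ) : partialMax x n / partialSum x n ≤ 1 := by
  have h0 : 0 ≤ partialSum x n := Finset.sum_nonneg fun _ _ => hx _
  exact div_le_one_of_le₀
    (partialMax_le h0 fun i hi => Finset.single_le_sum (fun j _ => hx j) hi) h0

lemma sum_rpow_le_rpow_sum {ι : Type*} (s : Finset ι) {f : ι → ℝ} (hf : ∀ i, 0 ≤ f i) {p : ℝ}
    (hp : 1 ≤ p) : ∑ i ∈ s, f i ^ p ≤ (∑ i ∈ s, f i) ^ p := by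
  classical
  induction s using Finset.induction_on with
  | empty => simp [Real.zero_rpow (by linarith : p ≠ 0)]
  | insert a s ha ih =>
    rw [Finset.sum_insert ha, Finset.sum_insert ha]
    exact (add_le_add_right ih _).trans
      (Real.add_rpow_le_rpow_add (hf a) (Finset.sum_nonneg fun i _ => hf i) hp)

lemma limsup_ratio_eq_one {t : ℕ → ℝ} (ht : ∀ i, 1 ≤ t i) {p : ℝ} (hp : 1 ≤ p)
    (hxt : ∀ i, x i = t i ^ p)
    (h : ∀ K : ℕ, ∃ᶠ n in atTop, K * ∑ i ∈ Finset.Icc 1 n, t i ≤ t (n + 1)) :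
    limsup (fun n : ℕ => ((partialMax x n / partialSum x n : ℝ) : EReal)) atTop = 1 := by
  have ht0 i : 0 ≤ t i := zero_le_one.trans (ht i)
  have hx i : 0 ≤ x i := hxt i ▸ Real.rpow_nonneg (ht0 i) p
  refine le_antisymm (limsup_le_of_le (h := Eventually.of_forall fun n => ?_)) ?_
  · exact_mod_cast ratio_le_one hx n
  have hlim : Tendsto (fun K : ℕ => (((K : ℝ) / (K + 1) : ℝ) : EReal)) atTop (nhds 1) :=
    (continuous_coe_real_ereal.tendsto 1).comp (tendsto_natCast_div_add_atTop (1 : ℝ))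
  refine le_of_tendsto hlim ?_
  filter_upwards [eventually_ge_atTop 1] with K hK
  have hK1 : (1 : ℝ) ≤ K := by exact_mod_cast hK
  refine le_limsup_of_frequently_le (frequently_atTop.2 fun M => ?_)
  obtain ⟨n, hn, hK'⟩ := frequently_atTop.1 (h K) M
  refine ⟨n + 1, by omega, EReal.coe_le_coe_iff.2 ?_⟩
  have hmax : x (n + 1) ≤ partialMax x (n + 1) := le_partialMax (by simp)
  have hsum : partialSum x (n + 1) = partialSum x n + x (n + 1) :=
    Finset.sum_Icc_succ_top (by omega) _
  have hS0 : 0 ≤ ∑ i ∈ Finset.Icc 1 n, t i := Finset.sum_nonneg fun i _ => ht0 i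
  have hprev : K * partialSum x n ≤ x (n + 1) := by
    -- Both `K ≤ K ^ p` and superadditivity of the power rely on `p ≥ 1`, that is, on `α ≤ 1`.
    calc K * partialSum x n ≤ (K : ℝ) ^ p * (∑ i ∈ Finset.Icc 1 n, t i) ^ p := by
          refine mul_le_mul (Real.self_le_rpow_of_one_le hK1 hp) ?_
            (Finset.sum_nonneg fun _ _ => hx _) (by positivity)
          rw [partialSum, Finset.sum_congr rfl fun i _ => hxt i]
          exact sum_rpow_le_rpow_sum _ ht0 hp
      _ = (K * ∑ i ∈ Finset.Icc 1 n, t i) ^ p := (Real.mul_rpow (by positivity) hS0).symm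
      _ ≤ x (n + 1) := by
          rw [hxt]
          exact Real.rpow_le_rpow (by positivity) hK' (by linarith)
  have hpos : 0 < x (n + 1) := by
    rw [hxt]; exact Real.rpow_pos_of_pos (zero_lt_one.trans_le (ht _)) p
  have hS : 0 ≤ partialSum x n := Finset.sum_nonneg fun _ _ => hx _
  rw [hsum, div_le_div_iff₀ (by positivity) (by positivity)]
  nlinarith

lemma liminf_ratio_eq_zero {t : ℕ → ℝ} (ht : ∀ i, 1 ≤ t i) {p : ℝ} (hp : 1 ≤ p)
    (hxt : ∀ i, x i = t i ^ p)
    (h : ∀ k : ℕ, 0 < k → ∃ᶠ n in atTop, ∃ y : ℝ, 0 < y ∧ (∀ i ∈ Finset.Icc 1 n, t i < 2 * y) ∧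
      ∃ s ⊆ Finset.Icc 1 n, k ≤ s.card ∧ ∀ i ∈ s, y ≤ t i) :
    liminf (fun n : ℕ => ((partialMax x n / partialSum x n : ℝ) : EReal)) atTop = 0 := by
  have ht0 i : 0 ≤ t i := zero_le_one.trans (ht i)
  have hx i : 0 ≤ x i := hxt i ▸ Real.rpow_nonneg (ht0 i) p
  refine le_antisymm ?_ (le_liminf_of_le (h := Eventually.of_forall fun n => ?_))
  swap
  · exact_mod_cast ratio_nonneg hx n
  have hlim : Tendsto (fun k : ℕ => (((2 : ℝ) ^ p / k : ℝ) : EReal)) atTop (nhds 0) :=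
    (continuous_coe_real_ereal.tendsto 0).comp (tendsto_const_div_atTop_nhds_zero_nat _)
  refine ge_of_tendsto hlim ?_
  filter_upwards [eventually_gt_atTop 0] with k hk
  refine liminf_le_of_frequently_le ((h k hk).mono ?_)
  rintro n ⟨y, hy, hlt, s, hs, hcard, hsy⟩
  refine EReal.coe_le_coe_iff.2 ?_
  have hk0 : (0 : ℝ) < k := by exact_mod_cast hk
  have hyp : 0 < y ^ p := Real.rpow_pos_of_pos hy p
  have hmax : partialMax x n ≤ 2 ^ p * y ^ p := by
    rw [← Real.mul_rpow (by norm_num) hy.le]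
    refine partialMax_le (by positivity) fun i hi => ?_
    rw [hxt]
    exact Real.rpow_le_rpow (ht0 i) (hlt i hi).le (by linarith)
  have hsum : k * y ^ p ≤ partialSum x n := by
    calc k * y ^ p ≤ s.card * y ^ p := by gcongr
      _ = ∑ _i ∈ s, y ^ p := by rw [Finset.sum_const, nsmul_eq_mul]
      _ ≤ ∑ i ∈ s, x i := Finset.sum_le_sum fun i hi => by
          rw [hxt]; exact Real.rpow_le_rpow hy.le (hsy i hi) (by linarith)
      _ ≤ partialSum x n := Finset.sum_le_sum_of_subset_of_nonneg hs fun i _ _ => hx i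
  have hpos : 0 < k * y ^ p := by positivity
  calc partialMax x n / partialSum x n ≤ (2 ^ p * y ^ p) / (k * y ^ p) :=
        div_le_div₀ (by positivity) hmax hpos hsum
    _ = 2 ^ p / k := mul_div_mul_right _ _ hyp.ne'

end Ratio

/-! ### Reduction to tail `1 / v`, and conclusion. -/

/-- The powers `σ ^ α` of independent variables with tail `u ^ (-α)` have tail `1 / v`. -/
lemma exists_isParetoSeq {Ω : Type*} [MeasurableSpace Ω] (P : Measure Ω) [IsProbabilityMeasure P]
    {α : ℝ} (hα : 0 < α) {σ : ℕ → Ω → ℝ} (h_indep : iIndepFun σ P)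
    (h_ident : ∀ i, IdentDistrib (σ i) (σ 0) P P)
    (h_tail : ∀ u : ℝ, 1 ≤ u → P {ω | u ≤ σ 0 ω} = ENNReal.ofReal (u ^ (-α))) :
    ∃ τ : ℕ → Ω → ℝ, IsParetoSeq P τ ∧ ∀ᵐ ω ∂P, ∀ i, σ i ω = τ i ω ^ α⁻¹ := by
  have hmeas i := (h_ident i).aemeasurable_fst
  -- The `σ i` are only a.e. measurable, hence the passage to measurable versions.
  let ρ : ℕ → Ω → ℝ := fun i => (hmeas i).mk (σ i)
  have hρ i : Measurable (ρ i) := (hmeas i).measurable_mk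
  have hσρ i : σ i =ᵐ[P] ρ i := (hmeas i).ae_eq_mk
  have htail i u (hu : 1 ≤ u) : P {ω | u ≤ ρ i ω} = ENNReal.ofReal (u ^ (-α)) := by
    rw [← h_tail u hu]
    refine (measure_congr ?_).trans
      ((h_ident i).measure_mem_eq (s := Set.Ici u) measurableSet_Ici)
    filter_upwards [hσρ i] with ω hω
    exact congrArg (fun z => u ≤ z) hω.symm
  have hone i : ∀ᵐ ω ∂P, 1 ≤ ρ i ω := by
    have : P {ω | 1 ≤ ρ i ω} = 1 := by simpa using htail i 1 le_rfl
    exact (prob_compl_eq_zero_iff (measurableSet_le measurable_const (hρ i))).2 this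
  -- Clipping at 1 gives the lower bound at every point and changes `ρ i` only on a null set.
  let g : ℝ → ℝ := fun z => max 1 z ^ α
  have hg : Measurable g := (measurable_const.max measurable_id).pow_const α
  refine ⟨fun i => g ∘ ρ i, ⟨fun i => hg.comp (hρ i), ?_, ?_, ?_⟩, ?_⟩
  · exact (h_indep.congr hσρ).comp (fun _ => g) fun _ => hg
  · exact fun i ω => Real.one_le_rpow (le_max_left _ _) hα.le
  · intro i v hv
    have hv0 : 0 < v := zero_lt_one.trans_le hv
    have hv1 : 1 ≤ v ^ α⁻¹ := Real.one_le_rpow hv (by positivity)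
    have : P {ω | v ≤ (g ∘ ρ i) ω} = P {ω | v ^ α⁻¹ ≤ ρ i ω} := by
      refine measure_congr ?_
      filter_upwards [hone i] with ω hω
      refine propext ?_
      change v ≤ max 1 (ρ i ω) ^ α ↔ v ^ α⁻¹ ≤ ρ i ω
      rw [max_eq_right hω, Real.rpow_inv_le_iff_of_pos hv0.le (by linarith) hα]
    rw [measureReal_def, this, htail i _ hv1, ← Real.rpow_mul hv0.le,
      ENNReal.toReal_ofReal (by positivity)]
    rw [mul_neg, inv_mul_cancel₀ hα.ne', Real.rpow_neg_one]
  · rw [ae_all_iff]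
    intro i
    filter_upwards [hσρ i, hone i] with ω h1 h2
    rw [h1]
    change ρ i ω = (max 1 (ρ i ω) ^ α) ^ α⁻¹
    rw [max_eq_right h2, Real.rpow_rpow_inv (by linarith) hα.ne']

/-- The lower and upper limits are taken in the complete lattice of extended reals, where they are
meaningful for every sequence. -/
theorem theorem2 {Ω : Type*} [MeasurableSpace Ω] (P : Measure Ω) [IsProbabilityMeasure P]
    (α : ℝ) (hα_pos : 0 < α) (hα_le : α ≤ 1)
    (σ : ℕ → Ω → ℝ)
    (h_indep : iIndepFun σ P)
    (h_ident : ∀ i, IdentDistrib (σ i) (σ 0) P P)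
    (h_tail : ∀ u : ℝ, 1 ≤ u → P {ω | u ≤ σ 0 ω} = ENNReal.ofReal (u ^ (-α))) :
    ∀ᵐ ω ∂P,
      liminf (fun n : ℕ =>
        ((partialMax (fun i => σ i ω) n / partialSum (fun i => σ i ω) n : ℝ) : EReal)) atTop = 0 ∧
      limsup (fun n : ℕ =>
        ((partialMax (fun i => σ i ω) n / partialSum (fun i => σ i ω) n : ℝ) : EReal)) atTop = 1 := by

  obtain ⟨τ, hτ, hστ⟩ := exists_isParetoSeq P hα_pos h_indep h_ident h_tail
  have hp : 1 ≤ α⁻¹ := (one_le_inv₀ hα_pos).2 hα_le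
  filter_upwards [hστ, ae_all_iff.2 hτ.ae_frequently_mul_sum_le,
    ae_all_iff.2 fun k => ae_all_iff.2 fun hk : 0 < k => hτ.ae_frequently_many_large hk]
    with ω h1 h2 h3
  exact ⟨liminf_ratio_eq_zero (hτ.one_le · ω) hp h1 h3,
    limsup_ratio_eq_one (hτ.one_le · ω) hp h1 h2⟩
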